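/- Let $N_d$ be the group of $(d+1)\times(d+1)$ lower-triangular integer matrices with all diagonal entries equal to $1$. It acts linearly on $\mathbb{Z}^{d+1}$ preserving $\{1\}\times\mathbb{Z}^d$, hence it acts on $\mathbb{Z}^d$. A Farb–Franks action of $N_d$ is an action $\phi_{FF}$ on $[0,1]$ by orientation-preserving homeomorphisms for which there is a family of nondegenerate closed intervals $I_v\subset[0,1]$, $v\in\mathbb{Z}^d$, with pairwise disjoint interiors, of total length $\sum_v|I_v|=1$ and placed in $[0,1]$ in the lexicographic order of their indices, such that every $g\in N_d$ maps each $I_v$ onto $I_{g(v)}$, by a map that depends only on $v$ and $g(v)$ (so an element that preserves $I_v$ is the identity on $I_v$). (Such actions exist, and the original $C^1$ action of Farb and Franks is one of them.) For $\alpha>0$, a $C^1$-diffeomorphism $f$ of $[0,1]$ is called a $C^{1+\alpha}$-diffeomorphism if there is a constant $M$ with $|f'(x)-f'(y)|\le M|x-y|^{\alpha}$ for all $x,y\in[0,1]$. Theorem A. If $d\ge 3$ and $\alpha>\frac{2}{d(d-1)}$, then no Farb–Franks action $\phi_{FF}$ of $N_d$ is topologically conjugate to an action of $N_d$ on $[0,1]$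 by $C^{1+\alpha}$-diffeomorphisms. -/

import Mathlib

open scoped unitInterval

namespace FarbFranks

/-- The group of `(d+1) × (d+1)` lower-triangular integer matrices whose diagonal entries
are all equal to `1`. -/
def N (d : ℕ) : Subgroup (Matrix.SpecialLinearGroup (Fin (d + 1)) ℤ) where
  carrier := {A | (∀ i, A i i = 1) ∧ ∀ i j, i < j → A i j = 0}
  one_mem' := by
    refine ⟨fun i => ?_, fun i j h => ?_⟩
    · simp
    · simp [Matrix.one_apply_ne h.ne]
  mul_mem' := by
    rintro A B ⟨hA1, hA0⟩ ⟨hB1, hB0⟩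
    refine ⟨fun i => ?_, fun i j h => ?_⟩
    · rw [Matrix.SpecialLinearGroup.coe_mul, Matrix.mul_apply, Finset.sum_eq_single i]
      · rw [hA1, hB1, one_mul]
      · intro k _ hk
        rcases lt_or_gt_of_ne hk with h | h
        · rw [hB0 k i h, mul_zero]
        · rw [hA0 i k h, zero_mul]
      · simp
    · rw [Matrix.SpecialLinearGroup.coe_mul, Matrix.mul_apply]
      refine Finset.sum_eq_zero fun k _ => ?_
      rcases lt_or_ge i k with hk | hk
      · rw [hA0 i k hk, zero_mul]
      · rw [hB0 k j (lt_of_le_of_lt hk h), mul_zero]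
  inv_mem' := by
    rintro A ⟨hA1, hA0⟩
    have hmul : (A : Matrix (Fin (d + 1)) (Fin (d + 1)) ℤ) * (A⁻¹ : _) = 1 := by
      rw [← Matrix.SpecialLinearGroup.coe_mul, mul_inv_cancel, Matrix.SpecialLinearGroup.coe_one]
    have hmul' : ((A⁻¹ : Matrix.SpecialLinearGroup (Fin (d + 1)) ℤ) :
        Matrix (Fin (d + 1)) (Fin (d + 1)) ℤ) * A = 1 := by
      rw [← Matrix.SpecialLinearGroup.coe_mul, inv_mul_cancel, Matrix.SpecialLinearGroup.coe_one]
    have h0 : ∀ i j, i < j → (A⁻¹ : Matrix.SpecialLinearGroup (Fin (d + 1)) ℤ) i j = 0 := by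
      let _ : Invertible (A : Matrix (Fin (d + 1)) (Fin (d + 1)) ℤ) := ⟨_, hmul', hmul⟩
      have hb : Matrix.BlockTriangular (A : Matrix (Fin (d + 1)) (Fin (d + 1)) ℤ)
          OrderDual.toDual := fun i j h => hA0 i j h
      have h := Matrix.blockTriangular_inv_of_blockTriangular hb
      rw [Matrix.inv_eq_left_inv hmul'] at h
      exact fun i j hij => h hij
    refine ⟨fun i => ?_, h0⟩
    have h := congrFun (congrFun hmul i) i
    rw [Matrix.mul_apply, Finset.sum_eq_single i, hA1, one_mul, Matrix.one_apply_eq] at h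
    · exact h
    · intro k _ hk
      rcases lt_or_gt_of_ne hk with h | h
      · rw [h0 k i h, mul_zero]
      · rw [hA0 i k h, zero_mul]
    · simp

/-- The action of `N d` on `ℤ^d` induced by its linear action on the invariant affine hyperplane
`1 × ℤ^d` of `ℤ^(d+1)`: if `A (1, v) = (1, w)`, then `act A v = w`. -/
def act {d : ℕ} (A : N d) (v : Fin d → ℤ) : Fin d → ℤ :=
  Fin.tail (Matrix.mulVec (A : Matrix.SpecialLinearGroup (Fin (d + 1)) ℤ).1
    (Fin.cons 1 v : Fin (d + 1) → ℤ))

/-- The hyperplane `1 × ℤ^d` is indeed invariant. -/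
theorem cons_act {d : ℕ} (A : N d) (v : Fin d → ℤ) :
    (Fin.cons 1 (act A v) : Fin (d + 1) → ℤ) =
      Matrix.mulVec (A : Matrix.SpecialLinearGroup (Fin (d + 1)) ℤ).1 (Fin.cons 1 v) := by
  have h : (Matrix.mulVec (A : Matrix.SpecialLinearGroup (Fin (d + 1)) ℤ).1
      (Fin.cons 1 v : Fin (d + 1) → ℤ)) 0 = 1 := by
    have h1 := A.2.1 0
    have h0 := A.2.2 0
    rw [Matrix.mulVec, dotProduct, Fin.sum_univ_succ, Finset.sum_eq_zero]
    · simpa using h1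
    · intro j _
      rw [h0 j.succ (Fin.succ_pos j), zero_mul]
  unfold act
  conv_rhs => rw [← Fin.cons_self_tail (Matrix.mulVec _ _), h]

theorem act_one {d : ℕ} (v : Fin d → ℤ) : act (1 : N d) v = v := by
  simp [act]

theorem act_mul {d : ℕ} (A B : N d) (v : Fin d → ℤ) : act (A * B) v = act A (act B v) := by
  conv_rhs => rw [act, cons_act, Matrix.mulVec_mulVec]
  rfl

/-- The family of intervals `I_v = [a v, b v]`, `v ∈ ℤ^d`, is nondegenerate, has total length `1`,
and is joined lexicographically on `[0,1]`. -/
structure IsLexFamily {d : ℕ} (a b : (Fin d → ℤ) → I) : Prop where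
  lt : ∀ v, a v < b v
  lex : ∀ v w, toLex v < toLex w → b v ≤ a w
  total : HasSum (fun v => (b v : ℝ) - (a v : ℝ)) 1

/-- `φ` is a Farb–Franks action: it is an action of `N d` by orientation-preserving homeomorphisms
of `[0,1]` for which there is a family of intervals `I_v`, `v ∈ ℤ^d`, of total length `1`, joined
lexicographically on `[0,1]`, such that each `g` sends `I_v` onto `I_(g v)`, by a map which
depends only on the two intervals (so that the maps used form an equivariant family, and elements
preserving an interval `I_v` act trivially on it). -/
def IsFarbFranksAction (d : ℕ) (φ : N d →* (I ≃ₜ I)) : Prop :=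
  (∀ g, Monotone (φ g)) ∧
  ∃ a b : (Fin d → ℤ) → I, IsLexFamily a b ∧
    (∀ g v, φ g '' Set.Icc (a v) (b v) = Set.Icc (a (act g v)) (b (act g v))) ∧
    ∀ g h v, act g v = act h v → Set.EqOn (φ g) (φ h) (Set.Icc (a v) (b v))

/-- A homeomorphism `f` of `[0,1]` is a `C^(1+α)`-diffeomorphism: it has a continuous, nowhere zero
derivative `f'` (one-sided at the end-points), and `|f' x - f' y| ≤ M |x - y|^α` for some `M`. -/
def IsHolderDiffeo (α : ℝ) (f : I ≃ₜ I) : Prop :=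
  ∃ f' : I → ℝ,
    (∀ x : I, HasDerivWithinAt (Set.IccExtend (zero_le_one' ℝ) fun t => (f t : ℝ)) (f' x)
      (Set.Icc 0 1) x) ∧
    Continuous f' ∧ (∀ x, f' x ≠ 0) ∧
    ∃ M : ℝ, ∀ x y : I, |f' x - f' y| ≤ M * |(x : ℝ) - (y : ℝ)| ^ α

/-- Two actions on `[0,1]` are topologically conjugate. -/
def TopConjugate {G : Type*} [Group G] (φ ψ : G →* (I ≃ₜ I)) : Prop :=
  ∃ h : I ≃ₜ I, ∀ g x, h (φ g x) = ψ g (h x)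

/-! The remaining facts show that Farb–Franks actions exist, by using affine maps between the
intervals. -/

section

open scoped Classical

theorem act_apply {d : ℕ} (A : N d) (v : Fin d → ℤ) (k : Fin d) :
    act A v k = (A : Matrix.SpecialLinearGroup (Fin (d + 1)) ℤ) k.succ 0 +
      ∑ j : Fin d, (A : Matrix.SpecialLinearGroup (Fin (d + 1)) ℤ) k.succ j.succ * v j := by
  simp [act, Fin.tail, Matrix.mulVec, dotProduct, Fin.sum_univ_succ]

theorem act_lt_act {d : ℕ} (A : N d) {v w : Fin d → ℤ} (h : toLex v < toLex w) :
    toLex (act A v) < toLex (act A w) := by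
  obtain ⟨i, hi, hlt⟩ := h
  have key : ∀ k, (∀ j, j < k → v j = w j) → act A w k - act A v k = w k - v k := by
    intro k hk
    rw [act_apply, act_apply, add_sub_add_left_eq_sub, ← Finset.sum_sub_distrib,
      Finset.sum_eq_single k]
    · rw [A.2.1 k.succ, one_mul, one_mul]
    · intro j _ hj
      rcases lt_or_gt_of_ne hj with h | h
      · rw [hk j h, sub_self]
      · rw [A.2.2 k.succ j.succ (Fin.succ_lt_succ_iff.2 h), zero_mul, zero_mul, sub_self]
    · simp
  refine ⟨i, fun j hj => ?_, ?_⟩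
  · have h1 := key j (fun m hm => hi m (hm.trans hj))
    have h2 : v j = w j := hi j hj
    change act A v j = act A w j
    omega
  · have h1 := key i hi
    have h2 : v i < w i := hlt
    change act A v i < act A w i
    omega

theorem lex_irrefl {d : ℕ} (v : Fin d → ℤ) : ¬ toLex v < toLex v := fun ⟨_, _, h⟩ => lt_irrefl _ h

theorem lex_trans {d : ℕ} {u v w : Fin d → ℤ} (h : toLex u < toLex v) (h' : toLex v < toLex w) :
    toLex u < toLex w := Pi.Lex.isStrictOrder.trans _ _ _ h h'

theorem lex_trichotomy {d : ℕ} (v w : Fin d → ℤ) :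
    toLex v < toLex w ∨ v = w ∨ toLex w < toLex v :=
  @lt_trichotomy (Lex (Fin d → ℤ)) _ (toLex v) (toLex w)

theorem act_lt_act_iff {d : ℕ} (A : N d) {v w : Fin d → ℤ} :
    toLex (act A v) < toLex (act A w) ↔ toLex v < toLex w := by
  refine ⟨fun h => ?_, act_lt_act A⟩
  have := act_lt_act A⁻¹ h
  rwa [← act_mul, ← act_mul, inv_mul_cancel, act_one, act_one] at this

def actEquiv {d : ℕ} (A : N d) : (Fin d → ℤ) ≃ (Fin d → ℤ) where
  toFun := act A
  invFun := act A⁻¹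
  left_inv v := by rw [← act_mul, inv_mul_cancel, act_one]
  right_inv v := by rw [← act_mul, mul_inv_cancel, act_one]

noncomputable def left {d : ℕ} (l : (Fin d → ℤ) → ℝ) (v : Fin d → ℤ) : ℝ :=
  ∑' w, if toLex w < toLex v then l w else 0

noncomputable def clamp (t : ℝ) : ℝ := max 0 (min t 1)

theorem clamp_nonneg (t : ℝ) : 0 ≤ clamp t := le_max_left _ _
theorem clamp_le_one (t : ℝ) : clamp t ≤ 1 := max_le zero_le_one (min_le_right _ _)
theorem clamp_mono : Monotone clamp := fun _ _ h => max_le_max le_rfl (min_le_min h le_rfl)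
theorem clamp_of_le {t : ℝ} (h : t ≤ 0) : clamp t = 0 := max_eq_left (min_le_of_left_le h)
theorem clamp_of_ge {t : ℝ} (h : 1 ≤ t) : clamp t = 1 := by simp [clamp, h]
theorem clamp_of_mem {t : ℝ} (h0 : 0 ≤ t) (h1 : t ≤ 1) : clamp t = t := by simp [clamp, h0, h1]
theorem continuous_clamp : Continuous clamp := by unfold clamp; fun_prop

/-- The increasing map of `[0,1]` that sends each `I_w` affinely onto `I_(A w)`. -/
noncomputable def affineMap {d : ℕ} (l : (Fin d → ℤ) → ℝ) (A : N d) (x : ℝ) : ℝ :=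
  ∑' w, l (act A w) * clamp ((x - left l w) / l w)

section

variable {d : ℕ} {l : (Fin d → ℤ) → ℝ}

theorem summable_left (hp : ∀ v, 0 < l v) (hs : HasSum l 1) (v : Fin d → ℤ) :
    Summable fun w => if toLex w < toLex v then l w else 0 := by
  refine Summable.of_nonneg_of_le (fun w => ?_) (fun w => ?_) hs.summable
  · split_ifs <;> simp [(hp w).le]
  · split_ifs <;> simp [(hp w).le]

theorem left_nonneg (hp : ∀ v, 0 < l v) (v : Fin d → ℤ) : 0 ≤ left l v :=
  tsum_nonneg fun w => by split_ifs <;> simp [(hp w).le]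

theorem left_add_le (hp : ∀ v, 0 < l v) (hs : HasSum l 1) {v w : Fin d → ℤ}
    (h : toLex v < toLex w) : left l v + l v ≤ left l w := by
  have h1 : HasSum (fun u => (if toLex u < toLex v then l u else 0) + if u = v then l v else 0)
      (left l v + l v) := (summable_left hp hs v).hasSum.add (hasSum_ite_eq v (l v))
  refine hasSum_le (fun u => ?_) h1 (summable_left hp hs w).hasSum
  by_cases huv : u = v
  · subst huv
    rw [if_neg (lex_irrefl u), if_pos rfl, if_pos h, zero_add]
  · simp only [huv, if_false, add_zero]
    split_ifs with h1 h2
    · exact le_rfl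
    · exact absurd (lex_trans h1 h) h2
    · exact (hp u).le
    · exact le_rfl

theorem left_add_le_one (hp : ∀ v, 0 < l v) (hs : HasSum l 1) (v : Fin d → ℤ) :
    left l v + l v ≤ 1 := by
  have h1 : HasSum (fun u => (if toLex u < toLex v then l u else 0) + if u = v then l v else 0)
      (left l v + l v) := (summable_left hp hs v).hasSum.add (hasSum_ite_eq v (l v))
  refine hasSum_le (fun u => ?_) h1 hs
  by_cases huv : u = v
  · subst huv
    rw [if_neg (lex_irrefl u), if_pos rfl, zero_add]
  · simp only [huv, if_false, add_zero]
    split_ifs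
    exacts [le_rfl, (hp u).le]

theorem hasSum_act (hs : HasSum l 1) (A : N d) : HasSum (fun w => l (act A w)) 1 :=
  (actEquiv A).hasSum_iff.2 hs

theorem left_act (A : N d) (v : Fin d → ℤ) :
    left l (act A v) = ∑' w, if toLex w < toLex v then l (act A w) else 0 := by
  rw [left, ← (actEquiv A).tsum_eq]
  refine tsum_congr fun w => ?_
  change (if toLex (act A w) < toLex (act A v) then l (act A w) else 0) = _
  simp only [act_lt_act_iff]

theorem summable_affineMap (hp : ∀ v, 0 < l v) (hs : HasSum l 1) (A : N d) (x : ℝ) :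
    Summable fun w => l (act A w) * clamp ((x - left l w) / l w) :=
  Summable.of_nonneg_of_le (fun _ => mul_nonneg (hp _).le (clamp_nonneg _))
    (fun _ => mul_le_of_le_one_right (hp _).le (clamp_le_one _)) (hasSum_act hs A).summable

theorem continuous_affineMap (hp : ∀ v, 0 < l v) (hs : HasSum l 1) (A : N d) :
    Continuous (affineMap l A) := by
  refine continuous_tsum (fun _ => ?_) (hasSum_act hs A).summable fun _ x => ?_
  · exact continuous_const.mul (continuous_clamp.comp (by fun_prop))
  · rw [Real.norm_eq_abs, abs_of_nonneg (mul_nonneg (hp _).le (clamp_nonneg _))]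
    exact mul_le_of_le_one_right (hp _).le (clamp_le_one _)

theorem monotone_affineMap (hp : ∀ v, 0 < l v) (hs : HasSum l 1) (A : N d) :
    Monotone (affineMap l A) := fun x y h =>
  (summable_affineMap hp hs A x).tsum_le_tsum
    (fun _ => mul_le_mul_of_nonneg_left
      (clamp_mono (div_le_div_of_nonneg_right (sub_le_sub_right h _) (hp _).le)) (hp _).le)
    (summable_affineMap hp hs A y)

theorem affineMap_mem (hp : ∀ v, 0 < l v) (hs : HasSum l 1) (A : N d) (x : ℝ) :
    affineMap l A x ∈ Set.Icc (0 : ℝ) 1 :=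
  ⟨tsum_nonneg fun _ => mul_nonneg (hp _).le (clamp_nonneg _),
    hasSum_le (fun _ => mul_le_of_le_one_right (hp _).le (clamp_le_one _))
      (summable_affineMap hp hs A x).hasSum (hasSum_act hs A)⟩

theorem affineMap_apply (hp : ∀ v, 0 < l v) (hs : HasSum l 1) (A : N d) (v : Fin d → ℤ) {t : ℝ}
    (h0 : 0 ≤ t) (h1 : t ≤ 1) :
    affineMap l A (left l v + t * l v) = left l (act A v) + t * l (act A v) := by
  rw [left_act, affineMap]
  have hsum : Summable fun w => if toLex w < toLex v then l (act A w) else 0 := by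
    refine Summable.of_nonneg_of_le (fun w => ?_) (fun w => ?_) (hasSum_act hs A).summable
    · split_ifs <;> simp [(hp _).le]
    · split_ifs <;> simp [(hp _).le]
  rw [← (hsum.hasSum.add (hasSum_ite_eq v (t * l (act A v)))).tsum_eq]
  refine tsum_congr fun w => ?_
  have hw := hp w
  have hv := hp v
  rcases lex_trichotomy w v with h | h | h
  · have hle := left_add_le hp hs h
    have hne : w ≠ v := fun e => lex_irrefl v (e ▸ h)
    rw [clamp_of_ge, if_pos h, if_neg hne, mul_one, add_zero]
    rw [le_div_iff₀ hw]
    nlinarith [mul_nonneg h0 hv.le]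
  · subst h
    rw [if_neg (lex_irrefl _), if_pos rfl, add_sub_cancel_left, mul_div_cancel_right₀ _ hw.ne',
      clamp_of_mem h0 h1, zero_add, mul_comm]
  · have hle := left_add_le hp hs h
    have hne : w ≠ v := fun e => lex_irrefl v (e ▸ h)
    have hnot : ¬ toLex w < toLex v := fun h' => lex_irrefl v (lex_trans h h')
    rw [clamp_of_le, if_neg hnot, if_neg hne, mul_zero, add_zero]
    refine div_nonpos_of_nonpos_of_nonneg ?_ hw.le
    nlinarith [mul_le_mul_of_nonneg_right h1 hv.le]

theorem exists_param (hp : ∀ v, 0 < l v) {v : Fin d → ℤ} {x : ℝ}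
    (hx : x ∈ Set.Icc (left l v) (left l v + l v)) :
    ∃ t, 0 ≤ t ∧ t ≤ 1 ∧ x = left l v + t * l v := by
  have hv := hp v
  refine ⟨(x - left l v) / l v, div_nonneg (sub_nonneg.2 hx.1) hv.le, ?_, ?_⟩
  · rw [div_le_one hv]
    linarith [hx.2]
  · rw [div_mul_cancel₀ _ hv.ne']
    ring

/-- The intervals fill up a dense subset of `[0,1]`. -/
theorem exists_mem_Ioo (hp : ∀ v, 0 < l v) (hs : HasSum l 1) {x y : ℝ} (hx : 0 ≤ x) (hxy : x < y)
    (hy : y ≤ 1) : ∃ z ∈ Set.Ioo x y, ∃ v, z ∈ Set.Icc (left l v) (left l v + l v) := by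
  by_contra! hcon
  let U : Set ℝ := ⋃ v, Set.Ioo (left l v) (left l v + l v)
  have hdisj : Disjoint U (Set.Ioo x y) := by
    rw [Set.disjoint_left]
    intro z hz hz'
    obtain ⟨v, hv⟩ := Set.mem_iUnion.1 hz
    exact hcon z hz' v (Set.Ioo_subset_Icc_self hv)
  have hU : MeasureTheory.volume U = 1 := by
    rw [MeasureTheory.measure_iUnion]
    · simp only [Real.volume_Ioo, add_sub_cancel_left]
      rw [← ENNReal.ofReal_tsum_of_nonneg (fun v => (hp v).le) hs.summable, hs.tsum_eq,
        ENNReal.ofReal_one]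
    · intro v w hvw
      refine Set.disjoint_left.2 fun z hz hz' => ?_
      rcases lex_trichotomy v w with h | h | h
      · linarith [left_add_le hp hs h, hz.2, hz'.1]
      · exact absurd h hvw
      · linarith [left_add_le hp hs h, hz.1, hz'.2]
    · exact fun v => measurableSet_Ioo
  have hsub : U ∪ Set.Ioo x y ⊆ Set.Icc 0 1 := by
    refine Set.union_subset (Set.iUnion_subset fun v z hz => ?_) fun z hz => ?_
    · exact ⟨(left_nonneg hp v).trans hz.1.le, hz.2.le.trans (left_add_le_one hp hs v)⟩
    · exact ⟨hx.trans hz.1.le, hz.2.le.trans hy⟩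
  have h := MeasureTheory.measure_mono (μ := MeasureTheory.volume) hsub
  rw [MeasureTheory.measure_union hdisj measurableSet_Ioo, hU, Real.volume_Ioo, Real.volume_Icc,
    sub_zero, ENNReal.ofReal_one] at h
  have hpos : 0 < ENNReal.ofReal (y - x) := ENNReal.ofReal_pos.2 (sub_pos.2 hxy)
  exact absurd h (not_le.2 (ENNReal.lt_add_right ENNReal.one_ne_top hpos.ne'))

/-- Two continuous maps that agree on all the intervals agree on `[0,1]`. -/
theorem eq_of_eq_on_intervals (hp : ∀ v, 0 < l v) (hs : HasSum l 1) {F G : ℝ → ℝ}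
    (hF : Continuous F) (hG : Continuous G)
    (h : ∀ v t, 0 ≤ t → t ≤ 1 → F (left l v + t * l v) = G (left l v + t * l v)) {x : ℝ}
    (hx : x ∈ Set.Icc (0 : ℝ) 1) : F x = G x := by
  have hcl : IsClosed {x | F x = G x} := isClosed_eq hF hG
  have hIoo : Set.Ioo (0 : ℝ) 1 ⊆ {x | F x = G x} := by
    intro z hz
    rw [← hcl.closure_eq, Metric.mem_closure_iff]
    intro ε hε
    obtain ⟨u, hu, v, huv⟩ := exists_mem_Ioo hp hs hz.1.le
      (lt_min (lt_add_of_pos_right z hε) hz.2) (min_le_right (z + ε) 1)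
    obtain ⟨t, h0, h1, rfl⟩ := exists_param hp huv
    refine ⟨_, h v t h0 h1, ?_⟩
    rw [Real.dist_eq, abs_sub_lt_iff]
    constructor <;> linarith [hu.1, hu.2, min_le_left (z + ε) 1]
  have := closure_minimal hIoo hcl
  rw [closure_Ioo zero_ne_one] at this
  exact this hx

theorem affineMap_mul (hp : ∀ v, 0 < l v) (hs : HasSum l 1) (A B : N d) {x : ℝ}
    (hx : x ∈ Set.Icc (0 : ℝ) 1) : affineMap l (A * B) x = affineMap l A (affineMap l B x) := by
  refine eq_of_eq_on_intervals hp hs (continuous_affineMap hp hs _)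
    ((continuous_affineMap hp hs A).comp (continuous_affineMap hp hs B)) (fun v t h0 h1 => ?_) hx
  rw [Function.comp_apply, affineMap_apply hp hs _ _ h0 h1, affineMap_apply hp hs _ _ h0 h1,
    affineMap_apply hp hs _ _ h0 h1, act_mul]

theorem affineMap_one (hp : ∀ v, 0 < l v) (hs : HasSum l 1) {x : ℝ}
    (hx : x ∈ Set.Icc (0 : ℝ) 1) : affineMap l 1 x = x := by
  refine eq_of_eq_on_intervals hp hs (continuous_affineMap hp hs _)
    continuous_id (fun v t h0 h1 => ?_) hx
  rw [affineMap_apply hp hs _ _ h0 h1, act_one, id]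

/-- The action of `N d` on `[0,1]` by the maps that are affine on the intervals. -/
noncomputable def affineAction (hp : ∀ v, 0 < l v) (hs : HasSum l 1) : N d →* (I ≃ₜ I) where
  toFun A :=
    { toFun := fun x => ⟨affineMap l A x, affineMap_mem hp hs A x⟩
      invFun := fun x => ⟨affineMap l A⁻¹ x, affineMap_mem hp hs A⁻¹ x⟩
      left_inv := fun x => Subtype.ext (by
        change affineMap l A⁻¹ (affineMap l A x) = x
        rw [← affineMap_mul hp hs _ _ x.2, inv_mul_cancel, affineMap_one hp hs x.2])
      right_inv := fun x => Subtype.ext (by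
        change affineMap l A (affineMap l A⁻¹ x) = x
        rw [← affineMap_mul hp hs _ _ x.2, mul_inv_cancel, affineMap_one hp hs x.2])
      continuous_toFun :=
        ((continuous_affineMap hp hs A).comp continuous_subtype_val).subtype_mk _
      continuous_invFun :=
        ((continuous_affineMap hp hs A⁻¹).comp continuous_subtype_val).subtype_mk _ }
  map_one' := Homeomorph.ext fun x => Subtype.ext (affineMap_one hp hs x.2)
  map_mul' A B := Homeomorph.ext fun x => Subtype.ext (affineMap_mul hp hs A B x.2)

theorem isFarbFranksAction_affineAction (hp : ∀ v, 0 < l v) (hs : HasSum l 1) :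
    IsFarbFranksAction d (affineAction hp hs) := by
  have hmem : ∀ v, left l v + l v ∈ I := fun v =>
    ⟨add_nonneg (left_nonneg hp v) (hp v).le, left_add_le_one hp hs v⟩
  have hmem' : ∀ v, left l v ∈ I := fun v =>
    ⟨left_nonneg hp v, (le_add_of_nonneg_right (hp v).le).trans (hmem v).2⟩
  have hsub : ∀ g v (x : I), x ∈ Set.Icc (⟨left l v, hmem' v⟩ : I) ⟨left l v + l v, hmem v⟩ →
      affineAction hp hs g x ∈
        Set.Icc (⟨left l (act g v), hmem' _⟩ : I) ⟨left l (act g v) + l (act g v), hmem _⟩ := by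
    intro g v x hx
    obtain ⟨t, h0, h1, ht⟩ := exists_param hp (v := v) (x := x) hx
    have h : affineMap l g x = left l (act g v) + t * l (act g v) := by
      rw [ht, affineMap_apply hp hs g v h0 h1]
    have hl := hp (act g v)
    constructor
    · change left l (act g v) ≤ affineMap l g x
      rw [h]
      exact le_add_of_nonneg_right (mul_nonneg h0 hl.le)
    · change affineMap l g x ≤ left l (act g v) + l (act g v)
      rw [h]
      exact add_le_add_right (mul_le_of_le_one_left hl.le h1) _
  refine ⟨fun g x y h => monotone_affineMap hp hs g h, fun v => ⟨left l v, hmem' v⟩,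
    fun v => ⟨left l v + l v, hmem v⟩, ⟨fun v => ?_, fun v w h => ?_, ?_⟩, fun g v => ?_,
    fun g h v hgh x hx => ?_⟩
  · exact Subtype.mk_lt_mk.2 (lt_add_of_pos_right _ (hp v))
  · exact Subtype.mk_le_mk.2 (left_add_le hp hs h)
  · simpa using hs
  · refine Set.Subset.antisymm (Set.image_subset_iff.2 fun x hx => hsub g v x hx) fun y hy => ?_
    refine ⟨affineAction hp hs g⁻¹ y, ?_, ?_⟩
    · have := hsub g⁻¹ (act g v) y hy
      simp only [← act_mul, inv_mul_cancel, act_one] at this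
      exact this
    · rw [← Homeomorph.mul_apply, ← map_mul, mul_inv_cancel, map_one, Homeomorph.one_apply]
  · obtain ⟨t, h0, h1, ht⟩ := exists_param hp (v := v) (x := x) hx
    refine Subtype.ext ?_
    change affineMap l g x = affineMap l h x
    rw [ht, affineMap_apply hp hs g v h0 h1, affineMap_apply hp hs h v h0 h1, hgh]

end

end

theorem exists_isFarbFranksAction (d : ℕ) : ∃ φ, IsFarbFranksAction d φ := by
  let _ := Encodable.ofCountable (Fin d → ℤ)
  obtain ⟨l, hp, c, hc, -⟩ := posSumOfEncodable one_pos (Fin d → ℤ)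
  have hc0 : 0 < c := (hp 0).trans_le (le_hasSum hc 0 fun v _ => (hp v).le)
  have hs : HasSum (fun v => l v / c) 1 := by
    have := hc.div_const c
    rwa [div_self hc0.ne'] at this
  exact ⟨_, isFarbFranksAction_affineAction (fun v => div_pos (hp v) hc0) hs⟩

end FarbFranks

/-! Group the intervals `I_(v, t)`, `t ∈ ℤ`, into rows indexed by `v ∈ ℤ^(d - 1)`. The elementary
matrices that do not involve the last coordinate generate a copy of `N (d - 1)`, which permutes the
rows, while the translations of the last coordinate preserve each row. Suppose that a conjugate
action is by `C^(1+β)`-diffeomorphisms, with `β ≤ 1`, let `λ v` be the length of the row of `v` in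
it, and let `R_k v` be the logarithm of the ratio between the lengths of its intervals `(v, k)`
and `(v, 0)`. The Hölder condition makes `R_k` vary by at most `C * λ v ^ β` when an elementary
matrix is applied to `v`, with `C` independent of `k`; and since the translation that takes `(v, 0)`
to `(v, k)` fixes both ends of the row, `|R_k v| ≤ C_k * λ v ^ β`.

There is an infinite path of elementary matrices starting at `0` along which `∑ λ ^ β` is finite.
Indeed, words of length of order `L` lead from a given point to `L ^ (d (d - 1) / 2)` distinct
points, at which the average of `λ ^ β` is at most `L ^ (-β d (d - 1) / 2)` because `∑ λ ≤ 1`. Hence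
words chosen at random for `L = 1, 2, 4, …` have finite expected cost when `β d (d - 1) / 2 > 1`.

Along this path `R_k` tends to `0`, so `|R_k 0|` is bounded independently of `k`. Then the
infinitely many intervals of the row of `0` have comparable lengths, which is absurd.
-/

namespace FarbFranks

section Paths

open scoped BigOperators

variable {G X : Type*} {f : X → ℝ}

/-- The sum of `f` over the points at which the letters of the word `w` are applied, when `w` acts
on `x` letter by letter, starting with its last letter. The endpoint `w.prod • x` is not counted. -/
def pathCost [Monoid G] [MulAction G X] (f : X → ℝ) : List G → X → ℝ
  | [], _ => 0
  | _ :: w, x => pathCost f w x + f (w.prod • x)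

section Monoid

variable [Monoid G] [MulAction G X]

theorem pathCost_append (f : X → ℝ) (u w : List G) (x : X) :
    pathCost f (u ++ w) x = pathCost f w x + pathCost f u (w.prod • x) := by
  induction u with
  | nil => simp only [List.nil_append, pathCost, add_zero]
  | cons g u ih =>
    simp only [List.cons_append, pathCost, ih, List.prod_append, mul_smul, add_assoc]

theorem pathCost_nonneg (hf : ∀ x, 0 ≤ f x) (w : List G) (x : X) : 0 ≤ pathCost f w x := by
  induction w with
  | nil => exact le_rfl
  | cons _ w ih => exact add_nonneg ih (hf _)

theorem le_pathCost (hf : ∀ x, 0 ≤ f x) {w : List G} (hw : w ≠ []) (x : X) :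
    f x ≤ pathCost f w x := by
  obtain ⟨u, g, rfl⟩ := (List.eq_nil_or_concat' w).resolve_left hw
  have hg : pathCost f [g] x = f x := by
    simp only [pathCost, List.prod_nil, one_smul, zero_add]
  rw [pathCost_append, hg]
  exact le_add_of_nonneg_right (pathCost_nonneg hf u _)

theorem abs_sub_le_mul_pathCost {T : Set G} {R : X → ℝ} {C : ℝ}
    (hR : ∀ g ∈ T, ∀ x, |R (g • x) - R x| ≤ C * f x) {w : List G} (hw : ∀ g ∈ w, g ∈ T) (x : X) :
    |R (w.prod • x) - R x| ≤ C * pathCost f w x := by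
  induction w with
  | nil => simp only [List.prod_nil, one_smul, sub_self, abs_zero, pathCost, mul_zero, le_refl]
  | cons g w ih =>
    obtain ⟨hg, hw⟩ := List.forall_mem_cons.1 hw
    rw [List.prod_cons, mul_smul, pathCost, mul_add, add_comm (C * _)]
    exact (abs_sub_le _ (R (w.prod • x)) _).trans (add_le_add (hR g hg _) (ih hw))

end Monoid

variable [Group G] [MulAction G X]

theorem expect_pathCost_le {ι : Type*} [Fintype ι] {B : ℝ}
    (hB : ∀ y : ι → X, y.Injective → 𝔼 i, f (y i) ≤ B) (w : List G) {y : ι → X}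
    (hy : y.Injective) : 𝔼 i, pathCost f w (y i) ≤ w.length * B := by
  induction w with
  | nil => simp [pathCost]
  | cons g w ih =>
    simp only [pathCost, Finset.expect_add_distrib, List.length_cons, Nat.cast_add, Nat.cast_one,
      add_mul, one_mul]
    exact add_le_add ih (hB _ ((MulAction.injective w.prod).comp hy))

/-- If `W c` starting at `x` leads to distinct points, then the words `W' c'` cost little on average
at these points, so some `c` is good both for the cost of `W c` and for the average to come. -/
theorem exists_pathCost_add_expect_le {ι κ : Type*} [Fintype ι] [Nonempty ι] [Fintype κ]
    [Nonempty κ] {B ℓ : ℝ} (hf : ∀ x, 0 ≤ f x) (hB : ∀ y : ι → X, y.Injective → 𝔼 i, f (y i) ≤ B)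
    (W : ι → List G) (W' : κ → List G) (hℓ : ∀ c, (W' c).length ≤ ℓ) {x : X}
    (hx : Function.Injective fun c => (W c).prod • x) :
    ∃ c, pathCost f (W c) x + 𝔼 c', pathCost f (W' c') ((W c).prod • x) ≤
      𝔼 c, pathCost f (W c) x + ℓ * B := by
  have hB0 : 0 ≤ B := (Finset.expect_nonneg fun c _ => hf _).trans (hB _ hx)
  have havg : 𝔼 c, 𝔼 c', pathCost f (W' c') ((W c).prod • x) ≤ ℓ * B := by
    rw [Finset.expect_comm]
    exact Finset.expect_le Finset.univ_nonempty fun c' _ =>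
      (expect_pathCost_le hB (W' c') hx).trans (mul_le_mul_of_nonneg_right (hℓ c') hB0)
  have hsum : 𝔼 c, (pathCost f (W c) x + 𝔼 c', pathCost f (W' c') ((W c).prod • x)) ≤
      𝔼 c, pathCost f (W c) x + ℓ * B := by
    rw [Finset.expect_add_distrib]
    exact add_le_add_right havg _
  obtain ⟨c, -, hc⟩ := Finset.exists_le_of_expect_le Finset.univ_nonempty hsum
  exact ⟨c, hc⟩

theorem exists_seq_append {Ω : ℕ → Type*} [∀ k, Nonempty (Ω k)]
    {W : ∀ k, Ω k → List G} {P : Set X} {r : ∀ k, Ω k → X → Prop}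
    (h : ∀ k, ∀ y ∈ P, ∃ c, (W k c).prod • y ∈ P ∧ r k c y) {x : X} (hx : x ∈ P) :
    ∃ (c : ∀ k, Ω k) (w : ℕ → List G), w 0 = [] ∧
      ∀ k, w (k + 1) = W k (c k) ++ w k ∧ r k (c k) ((w k).prod • x) := by
  choose! c hcP hcr using h
  let w : ℕ → List G := fun n => n.rec [] fun k u => W k (c k (u.prod • x)) ++ u
  have hwP : ∀ n, (w n).prod • x ∈ P := fun n => by
    induction n with
    | zero => rwa [show w 0 = [] from rfl, List.prod_nil, one_smul]
    | succ n ih =>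
      rw [show w (n + 1) = W n (c n ((w n).prod • x)) ++ w n from rfl, List.prod_append, mul_smul]
      exact hcP n _ ih
  exact ⟨fun k => c k ((w k).prod • x), w, rfl, fun k => ⟨rfl, hcr k _ (hwP k)⟩⟩

/-- Choosing from each family `W k` a word that does not cost more than the average, we obtain an
infinite path whose cost stays bounded. -/
theorem exists_words_pathCost_le {Ω : ℕ → Type*} [∀ k, Fintype (Ω k)] [∀ k, Nonempty (Ω k)]
    {W : ∀ k, Ω k → List G} {T : Set G} {P : Set X} {ℓ B : ℕ → ℝ} (hf : ∀ x, 0 ≤ f x)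
    (hne : ∀ k c, W k c ≠ []) (hT : ∀ k c, ∀ g ∈ W k c, g ∈ T)
    (hP : ∀ k c, ∀ x ∈ P, (W k c).prod • x ∈ P)
    (hinj : ∀ k, ∀ x ∈ P, Function.Injective fun c => (W k c).prod • x)
    (hℓ : ∀ k c, (W k c).length ≤ ℓ k)
    (hB : ∀ k (y : Ω k → X), y.Injective → 𝔼 c, f (y c) ≤ B k)
    (hsum : Summable fun k => ℓ (k + 1) * B k) {x : X} (hx : x ∈ P) :
    ∃ (S : ℝ) (w : ℕ → List G), (∀ n, ∀ g ∈ w n, g ∈ T) ∧ (∀ n, pathCost f (w n) x ≤ S) ∧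
      Filter.Tendsto (fun n => f ((w n).prod • x)) Filter.atTop (nhds 0) := by
  let Φ : ℕ → X → ℝ := fun k y => 𝔼 c, pathCost f (W k c) y
  have hΦ : ∀ k y, 0 ≤ Φ k y := fun k y => Finset.expect_nonneg fun c _ => pathCost_nonneg hf _ _
  obtain ⟨c, w, hw0, hw⟩ := exists_seq_append (r := fun k c y =>
    pathCost f (W k c) y + Φ (k + 1) ((W k c).prod • y) ≤ Φ k y + ℓ (k + 1) * B k)
    (fun k y hy => (exists_pathCost_add_expect_le hf (hB k) (W k) (W (k + 1)) (hℓ (k + 1))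
      (hinj k y hy)).imp fun c hc => ⟨hP k c y hy, hc⟩) hx
  have hwT : ∀ n, ∀ g ∈ w n, g ∈ T := fun n => by
    induction n with
    | zero => exact hw0 ▸ fun g hg => absurd hg List.not_mem_nil
    | succ n ih => exact (hw n).1 ▸ List.forall_mem_append.2 ⟨hT n _, ih⟩
  have hcost : ∀ n, pathCost f (w n) x + Φ n ((w n).prod • x) ≤
      Φ 0 x + ∑ k ∈ Finset.range n, ℓ (k + 1) * B k := fun n => by
    induction n with
    | zero => simp [hw0, pathCost]
    | succ n ih =>
      rw [(hw n).1, pathCost_append, List.prod_append, mul_smul, Finset.sum_range_succ]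
      linarith [(hw n).2]
  have hℓB : ∀ k, 0 ≤ ℓ (k + 1) * B k := fun k =>
    mul_nonneg ((Nat.cast_nonneg _).trans (hℓ (k + 1) (Classical.arbitrary _)))
      ((Finset.expect_nonneg fun c _ => hf _).trans (hB k _ (hinj k x hx)))
  have hS : ∀ n, pathCost f (w n) x ≤ Φ 0 x + ∑' k, ℓ (k + 1) * B k := fun n => by
    linarith [hcost n, hΦ n ((w n).prod • x),
      hsum.sum_le_tsum (Finset.range n) fun k _ => hℓB k]
  have hsumf : ∀ n, ∑ k ∈ Finset.range n, f ((w k).prod • x) ≤ pathCost f (w n) x := fun n => by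
    induction n with
    | zero => simp [hw0, pathCost]
    | succ n ih =>
      rw [(hw n).1, pathCost_append, Finset.sum_range_succ]
      exact add_le_add ih (le_pathCost hf (hne n _) _)
  exact ⟨_, w, hwT, hS, (summable_of_sum_range_le (fun k => hf _) fun n =>
    (hsumf n).trans (hS n)).tendsto_atTop_zero⟩

theorem abs_le_mul_of_tendsto {T : Set G} {R : X → ℝ} {C C' S : ℝ} {w : ℕ → List G} {x : X}
    (hC : 0 ≤ C) (hR : ∀ g ∈ T, ∀ y, |R (g • y) - R y| ≤ C * f y) (hR' : ∀ y, |R y| ≤ C' * f y)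
    (hw : ∀ n, ∀ g ∈ w n, g ∈ T) (hS : ∀ n, pathCost f (w n) x ≤ S)
    (hlim : Filter.Tendsto (fun n => f ((w n).prod • x)) Filter.atTop (nhds 0)) :
    |R x| ≤ C * S := by
  have hzero : Filter.Tendsto (fun n => R ((w n).prod • x)) Filter.atTop (nhds 0) :=
    squeeze_zero_norm (fun n => hR' _) (by simpa only [mul_zero] using hlim.const_mul C')
  have hdiff : ∀ n, |R ((w n).prod • x) - R x| ≤ C * S := fun n =>
    (abs_sub_le_mul_pathCost hR (hw n) x).trans (mul_le_mul_of_nonneg_left (hS n) hC)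
  simpa only [zero_sub, abs_neg] using
    le_of_tendsto (hzero.sub_const (R x)).abs (Filter.Eventually.of_forall hdiff)

theorem expect_rpow_le_card_rpow_neg {ι : Type*} [Fintype ι] [Nonempty ι] {p : ι → ℝ}
    (hp : ∀ i, 0 ≤ p i) (hp1 : ∑ i, p i ≤ 1) {β : ℝ} (hβ0 : 0 ≤ β) (hβ1 : β ≤ 1) :
    𝔼 i, p i ^ β ≤ (Fintype.card ι : ℝ) ^ (-β) := by
  have hcard : (0 : ℝ) < Fintype.card ι := Nat.cast_pos.2 Fintype.card_pos
  have hjensen := (Real.concaveOn_rpow hβ0 hβ1).le_map_sum (t := Finset.univ)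
    (w := fun _ : ι => (Fintype.card ι : ℝ)⁻¹) (p := p) (fun _ _ => inv_nonneg.2 hcard.le)
    (by simp [hcard.ne']) fun i _ => hp i
  simp only [smul_eq_mul, ← Finset.mul_sum] at hjensen
  rw [Fintype.expect_eq_sum_div_card, div_eq_inv_mul, Real.rpow_neg hcard.le,
    ← Real.inv_rpow hcard.le]
  exact hjensen.trans (Real.rpow_le_rpow (mul_nonneg (inv_nonneg.2 hcard.le)
    (Finset.sum_nonneg fun i _ => hp i)) (mul_le_of_le_one_right (inv_nonneg.2 hcard.le) hp1) hβ0)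

end Paths

section Shear

variable {d : ℕ}

instance : MulAction (N d) (Fin d → ℤ) where
  smul := act
  one_smul := act_one
  mul_smul := act_mul

/-- The homogeneous coordinates `1, v 0, …, v (i - 1)` that precede `v i` in the vector `(1, v)`. -/
def precedingCoords (v : Fin d → ℤ) (i : Fin d) : Fin (i + 1) → ℤ :=
  fun j => (Fin.cons 1 v : Fin (d + 1) → ℤ) (j.castLE (by omega))

theorem precedingCoords_congr {v w : Fin d → ℤ} {i : Fin d} (h : ∀ k < i, v k = w k) :
    precedingCoords v i = precedingCoords w i := by
  funext ⟨j, hj⟩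
  cases j with
  | zero => rfl
  | succ j => exact h ⟨j, by omega⟩ (Nat.lt_of_succ_lt_succ hj)

theorem precedingCoords_nonneg {v : Fin d → ℤ} {i : Fin d} (h : ∀ k < i, 0 ≤ v k)
    (j : Fin (i + 1)) : 0 ≤ precedingCoords v i j := by
  obtain ⟨j, hj⟩ := j
  cases j with
  | zero => exact zero_le_one
  | succ j => exact h ⟨j, by omega⟩ (Nat.lt_of_succ_lt_succ hj)

/-- The unipotent matrix that adds `c` times the homogeneous coordinate number `j` to `v i`. -/
def shear (i : Fin d) (j : Fin (i + 1)) (c : ℤ) : N d :=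
  have hji : j.castLE (by omega) < i.succ := j.2
  ⟨Matrix.SpecialLinearGroup.transvection hji.ne' c, by
    refine ⟨fun k => ?_, fun k l hkl => ?_⟩
    · have hk : ¬ (i.succ = k ∧ j.castLE (by omega) = k) := fun h => hji.ne (h.2.trans h.1.symm)
      simp [Matrix.SpecialLinearGroup.transvection, Matrix.transvection, hk]
    · have hk : ¬ (i.succ = k ∧ j.castLE (by omega) = l) := by
        rintro ⟨rfl, h⟩
        exact absurd (h ▸ hji) hkl.not_gt
      simp [Matrix.SpecialLinearGroup.transvection, Matrix.transvection, hk,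
        Matrix.one_apply_ne hkl.ne]⟩

theorem shear_smul (i : Fin d) (j : Fin (i + 1)) (c : ℤ) (v : Fin d → ℤ) :
    shear i j c • v = Function.update v i (v i + c * precedingCoords v i j) := by
  have hcons : (Fin.cons 1 (shear i j c • v) : Fin (d + 1) → ℤ) =
      (Fin.cons 1 v : Fin (d + 1) → ℤ) + Pi.single i.succ (c * precedingCoords v i j) := by
    rw [show shear i j c • v = act (shear i j c) v from rfl, cons_act]
    change Matrix.mulVec (Matrix.transvection _ _ c) _ = _
    rw [Matrix.transvection, Matrix.add_mulVec, Matrix.one_mulVec, Matrix.single_mulVec]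
    rfl
  funext k
  have hk := congrFun hcons k.succ
  rw [Fin.cons_succ, Pi.add_apply, Fin.cons_succ] at hk
  rw [hk]
  rcases eq_or_ne k i with rfl | hki
  · rw [Pi.single_eq_same, Function.update_self]
  · rw [Pi.single_eq_of_ne ((Fin.succ_injective _).ne hki), Function.update_of_ne hki, add_zero]

theorem shear_castSucc_smul_snoc (i : Fin d) (j : Fin (i + 1)) (c : ℤ) (v : Fin d → ℤ) (t : ℤ) :
    (shear i.castSucc j c • Fin.snoc v t : Fin (d + 1) → ℤ) = Fin.snoc (shear i j c • v) t := by
  have hcoord : precedingCoords (Fin.snoc v t : Fin (d + 1) → ℤ) i.castSucc j =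
      precedingCoords v i j := by
    unfold precedingCoords
    rw [Fin.cons_snoc_eq_snoc_cons]
    exact Fin.snoc_castSucc (α := fun _ => ℤ) t (Fin.cons 1 v) (j.castLE _)
  rw [shear_smul, shear_smul, Fin.snoc_update, Fin.snoc_castSucc, hcoord]

theorem shear_last_zero_smul_snoc (c : ℤ) (v : Fin d → ℤ) (t : ℤ) :
    (shear (Fin.last d) 0 c • Fin.snoc v t : Fin (d + 1) → ℤ) = Fin.snoc v (t + c) := by
  rw [shear_smul, Fin.snoc_last, Fin.update_snoc_last, show precedingCoords _ (Fin.last d) 0 = 1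
    from rfl, mul_one]

end Shear

section Words

variable {d : ℕ}

/-- The word of elementary matrices that adds `∑ j, e j * z j` to `v i`, where `z` is the sequence
`1, v 0, …, v (i - 1)`. -/
def rowWord (i : Fin d) (e : Fin (i + 1) → ℕ) : List (N d) :=
  (List.finRange (i + 1)).flatMap fun j => List.replicate (e j) (shear i j 1)

theorem rowWord_prod_smul (i : Fin d) (e : Fin (i + 1) → ℕ) (v : Fin d → ℤ) :
    (rowWord i e).prod • v = Function.update v i (v i + ∑ j, e j * precedingCoords v i j) := by
  have hpow : ∀ (j : Fin (i + 1)) (n : ℕ) (a : ℤ),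
      (List.replicate n (shear i j 1)).prod • Function.update v i a =
        Function.update v i (a + n * precedingCoords v i j) := fun j n a => by
    induction n with
    | zero => simp
    | succ n ih =>
      rw [List.replicate_succ, List.prod_cons, mul_smul, ih, shear_smul, Function.update_self,
        Function.update_idem, precedingCoords_congr (v := Function.update v i _) (w := v)
          fun k hk => Function.update_of_ne hk.ne _ _]
      push_cast
      ring_nf
  have hlist : ∀ l : List (Fin (i + 1)),
      (l.flatMap fun j => List.replicate (e j) (shear i j 1)).prod • v =
        Function.update v i (v i + (l.map fun j => e j * precedingCoords v i j).sum) := fun l => by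
    induction l with
    | nil => simp
    | cons j l ih =>
      rw [List.flatMap_cons, List.prod_append, mul_smul, ih, hpow, List.map_cons, List.sum_cons,
        add_assoc, add_comm (List.sum _)]
  rw [rowWord, hlist, ← Fin.sum_univ_def]

/-- The word that applies `rowWord i (e i)` for `i = 0, 1, …, d - 1`, in this order. -/
def blockWord (e : ∀ i : Fin d, Fin (i + 1) → ℕ) : List (N d) :=
  (List.finRange d).reverse.flatMap fun i => rowWord i (e i)

theorem blockWord_prod_smul_apply (e : ∀ i : Fin d, Fin (i + 1) → ℕ) (v : Fin d → ℤ) (i : Fin d) :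
    ((blockWord e).prod • v) i =
      v i + ∑ j, e i j * precedingCoords ((blockWord e).prod • v) i j := by
  have hlist : ∀ l : List (Fin d), l.Pairwise (· > ·) → ∀ i,
      ((l.flatMap fun i => rowWord i (e i)).prod • v) i = v i + if i ∈ l then
        ∑ j, e i j * precedingCoords ((l.flatMap fun i => rowWord i (e i)).prod • v) i j
      else 0 := fun l hl => by
    induction l with
    | nil => simp
    | cons k l ih =>
      obtain ⟨hkl, hl⟩ := List.pairwise_cons.1 hl
      replace ih := ih hl
      intro i
      have hk : k ∉ l := fun h => lt_irrefl k (hkl k h)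
      rw [List.flatMap_cons, List.prod_append, mul_smul, rowWord_prod_smul]
      generalize (l.flatMap fun i => rowWord i (e i)).prod • v = w at ih
      have hprec : ∀ a, ∀ i ≤ k, precedingCoords (Function.update w k a) i = precedingCoords w i :=
        fun a i hi => precedingCoords_congr fun l hl =>
          Function.update_of_ne (hl.trans_le hi).ne _ _
      rcases eq_or_ne i k with rfl | hik
      · rw [Function.update_self, hprec _ _ le_rfl, if_pos List.mem_cons_self, ih, if_neg hk,
          add_zero]
      · rw [Function.update_of_ne hik, ih]
        simp only [List.mem_cons, hik, false_or]
        split_ifs with hi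
        · rw [hprec _ _ (hkl i hi).le]
        · rfl
  have hall := hlist _ (List.pairwise_reverse.2 (List.pairwise_lt_finRange d)) i
  rwa [if_pos (List.mem_reverse.2 (List.mem_finRange i))] at hall

end Words

section Numeration

theorem forall_pos_of_mul_castSucc_le {L : ℕ} (hL : 0 < L) {n : ℕ} {y : Fin (n + 1) → ℤ}
    (h0 : 0 < y 0) (hy : ∀ j : Fin n, L * y j.castSucc ≤ y j.succ) (j : Fin (n + 1)) : 0 < y j :=
  j.induction h0 fun j hj => (mul_pos (Nat.cast_pos.2 hL) hj).trans_le (hy j)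

theorem sum_digits_mul_lt {L : ℕ} {n : ℕ} {y : Fin (n + 1) → ℤ} (hpos : ∀ j, 0 < y j)
    (hy : ∀ j : Fin n, L * y j.castSucc ≤ y j.succ) (c : Fin n → Fin L) :
    ∑ j, (c j : ℤ) * y j.castSucc < y (Fin.last n) := by
  induction n with
  | zero => simpa using hpos 0
  | succ n ih =>
    have hinit : ∑ j, (c (Fin.castSucc j) : ℤ) * y j.castSucc.castSucc < y (Fin.last n).castSucc :=
      ih (fun j => hpos j.castSucc) (fun j => hy j.castSucc) fun j => c j.castSucc
    have hdigit : (c (Fin.last n) : ℤ) + 1 ≤ L := mod_cast (c (Fin.last n)).2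
    calc ∑ j, (c j : ℤ) * y j.castSucc
        < (c (Fin.last n) + 1) * y (Fin.last n).castSucc := by
          rw [Fin.sum_univ_castSucc]; linarith
      _ ≤ L * y (Fin.last n).castSucc := mul_le_mul_of_nonneg_right hdigit (hpos _).le
      _ ≤ y (Fin.last (n + 1)) := hy (Fin.last n)

theorem sum_digits_mul_injective {L : ℕ} {n : ℕ} {y : Fin (n + 1) → ℤ} (hpos : ∀ j, 0 < y j)
    (hy : ∀ j : Fin n, L * y j.castSucc ≤ y j.succ) :
    Function.Injective fun c : Fin (n + 1) → Fin L => ∑ j, (c j : ℤ) * y j := by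
  induction n with
  | zero =>
    intro c c' h
    refine funext (Fin.forall_fin_one.2 ?_)
    simpa [(hpos 0).ne', Fin.ext_iff] using h
  | succ n ih =>
    intro c c' h
    let z : Fin (n + 1) → ℤ := fun j => y j.castSucc
    have hlast : ∀ c : Fin (n + 2) → Fin L,
        (∑ j, (c j : ℤ) * y j) / y (Fin.last _) = c (Fin.last _) ∧
        (∑ j, (c j : ℤ) * y j) % y (Fin.last _) = ∑ j, (c (Fin.castSucc j) : ℤ) * z j := fun c => by
      refine (Int.ediv_emod_unique (hpos _)).2 ⟨?_, ?_, sum_digits_mul_lt hpos hy _⟩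
      · rw [Fin.sum_univ_castSucc (n := n + 1), mul_comm (y _)]
      · exact Finset.sum_nonneg fun j _ => mul_nonneg (Nat.cast_nonneg _) (hpos _).le
    have hinit := ih (y := z) (fun j => hpos _) (fun j => hy j.castSucc)
      ((hlast c).2.symm.trans ((congrArg (· % y (Fin.last _)) h).trans (hlast c').2))
    have htop := (hlast c).1.symm.trans ((congrArg (· / y (Fin.last _)) h).trans (hlast c').1)
    funext j
    exact j.lastCases (Fin.ext (Nat.cast_injective htop)) (congrFun hinit)

end Numeration

section Words

variable {m : ℕ}

/-- The elementary matrices, whose entries off the diagonal are a single `1` and zeros. -/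
def generators (m : ℕ) : Set (N m) :=
  Set.range fun p : Σ i : Fin m, Fin (i + 1) => shear p.1 p.2 1

theorem mem_generators_of_mem_blockWord (e : ∀ i : Fin m, Fin (i + 1) → ℕ) :
    ∀ g ∈ blockWord e, g ∈ generators m := fun g hg => by
  obtain ⟨i, -, hi⟩ := List.mem_flatMap.1 hg
  obtain ⟨j, -, hj⟩ := List.mem_flatMap.1 hi
  exact ⟨⟨i, j⟩, (List.eq_of_mem_replicate hj).symm⟩

theorem length_blockWord (e : ∀ i : Fin m, Fin (i + 1) → ℕ) :
    (blockWord e).length = ∑ i, ∑ j, e i j := by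
  simp only [blockWord, rowWord, List.length_flatMap, List.length_replicate, List.map_reverse,
    List.sum_reverse, Fin.sum_univ_def]

theorem blockWord_smul_nonneg (e : ∀ i : Fin m, Fin (i + 1) → ℕ) {v : Fin m → ℤ} (hv : 0 ≤ v) :
    0 ≤ (blockWord e).prod • v := fun i => by
  induction i using Fin.strong_induction_on with
  | _ i ih =>
    rw [blockWord_prod_smul_apply]
    exact add_nonneg (hv i) (Finset.sum_nonneg fun j _ =>
      mul_nonneg (Nat.cast_nonneg _) (precedingCoords_nonneg ih j))

/-- The digits in base `L` that parametrize the words `Digits.word`: one for each entry of a matrix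
below the diagonal. -/
abbrev Digits (m L : ℕ) : Type := ∀ i : Fin m, Fin (i + 1) → Fin L

theorem sum_fin_succ_eq_choose_two (m : ℕ) : ∑ i : Fin m, ((i : ℕ) + 1) = (m + 1).choose 2 := by
  rw [Fin.sum_univ_eq_sum_range (· + 1) m, Nat.choose_two_right, ← Finset.sum_range_id,
    Finset.sum_range_succ', add_zero]

theorem card_digits (m L : ℕ) : Fintype.card (Digits m L) = L ^ (m + 1).choose 2 := by
  simp only [Fintype.card_pi, Fintype.card_fin, Finset.prod_const, Finset.card_univ,
    Finset.prod_pow_eq_pow_sum, sum_fin_succ_eq_choose_two]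

namespace Digits

variable {L : ℕ}

/-- The block word with exponents `c i j`, raised by `L` for the last letter of each row: this makes
every coordinate of the endpoint at least `L` times the preceding one. -/
def word (c : Digits m L) : List (N m) :=
  blockWord fun i j => c i j + if j = Fin.last i then L else 0

theorem length_word_le (c : Digits m L) : (word c).length ≤ (m + 1).choose 2 * (2 * L) := by
  have hle : ∀ i j, (c i j : ℕ) + (if j = Fin.last i then L else 0) ≤ 2 * L := fun i j => by
    have := (c i j).2
    split_ifs <;> omega
  rw [word, length_blockWord, ← sum_fin_succ_eq_choose_two, Finset.sum_mul]
  refine Finset.sum_le_sum fun i _ => (Finset.sum_le_sum fun j _ => hle i j).trans_eq ?_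
  rw [Finset.sum_const, Finset.card_univ, Fintype.card_fin, smul_eq_mul]

theorem word_ne_nil [NeZero m] [NeZero L] (c : Digits m L) : word c ≠ [] := by
  refine List.ne_nil_of_length_pos ?_
  rw [word, length_blockWord]
  refine Finset.sum_pos' (fun i _ => Nat.zero_le _) ⟨0, Finset.mem_univ _, ?_⟩
  refine Finset.sum_pos' (fun j _ => Nat.zero_le _) ⟨Fin.last _, Finset.mem_univ _, ?_⟩
  rw [if_pos rfl]
  exact Nat.add_pos_right _ (NeZero.pos L)

theorem mul_precedingCoords_le (c : Digits m L) {v : Fin m → ℤ} (hv : 0 ≤ v) (i : Fin m) :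
    L * precedingCoords ((word c).prod • v) i (Fin.last i) ≤ ((word c).prod • v) i := by
  have hprec := precedingCoords_nonneg (i := i)
    fun k _ => blockWord_smul_nonneg (fun i j => c i j + if j = Fin.last i then L else 0) hv k
  nth_rw 2 [word]
  rw [blockWord_prod_smul_apply]
  refine le_add_of_nonneg_of_le (hv i) ?_
  refine le_trans ?_ (Finset.single_le_sum (fun j _ => mul_nonneg (Nat.cast_nonneg _) (hprec j))
    (Finset.mem_univ (Fin.last i)))
  refine mul_le_mul_of_nonneg_right ?_ (hprec _)
  simp

theorem word_prod_smul_injective [NeZero L] {v : Fin m → ℤ} (hv : 0 ≤ v) :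
    Function.Injective fun c : Digits m L => (word c).prod • v := fun c c' h => by
  funext i
  have hy : ∀ j : Fin i, L * precedingCoords ((word c).prod • v) i j.castSucc ≤
      precedingCoords ((word c).prod • v) i j.succ :=
    fun j => mul_precedingCoords_le c hv ⟨j, j.2.trans i.2⟩
  have hsum : ∀ c : Digits m L, ((word c).prod • v) i =
      v i + (∑ j, (c i j : ℤ) * precedingCoords ((word c).prod • v) i j +
        ∑ j, ((if j = Fin.last i then L else 0 : ℕ) : ℤ) *
          precedingCoords ((word c).prod • v) i j) := fun c => by
    nth_rw 1 [word]
    rw [blockWord_prod_smul_apply, ← Finset.sum_add_distrib]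
    simp only [Nat.cast_add, add_mul]
    rfl
  refine sum_digits_mul_injective (forall_pos_of_mul_castSucc_le (NeZero.pos L) one_pos hy) hy ?_
  replace h : (word c).prod • v = (word c').prod • v := h
  have hc := hsum c
  rw [h, hsum c'] at hc
  simpa only [h, add_right_inj, add_left_inj] using hc.symm

end Digits
theorem summable_length_mul_card_rpow_neg {D : ℕ} {β : ℝ} (hβ : 1 < β * D) :
    Summable fun k : ℕ => ((D * (2 * 2 ^ (k + 1)) : ℕ) : ℝ) * (((2 ^ k) ^ D : ℕ) : ℝ) ^ (-β) := by
  have hr1 : (2 : ℝ) ^ (1 - β * D) < 1 := Real.rpow_lt_one_of_one_lt_of_neg one_lt_two (by linarith)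
  refine ((summable_geometric_of_lt_one (by positivity) hr1).mul_left (4 * D : ℝ)).congr fun k => ?_
  have hcard : (((2 ^ k) ^ D : ℕ) : ℝ) ^ (-β) = (2 : ℝ) ^ ((-(β * D)) * k) := by
    rw [← pow_mul, Nat.cast_pow, Nat.cast_two, ← Real.rpow_natCast, ← Real.rpow_mul zero_le_two]
    push_cast
    ring_nf
  rw [hcard, ← Real.rpow_mul_natCast zero_le_two, sub_mul, one_mul, sub_eq_add_neg,
    Real.rpow_add two_pos, Real.rpow_natCast, neg_mul]
  push_cast
  ring

/-- There are `2 ^ (k * D)` block words with digits below `2 ^ k`, where `D = (m + 1).choose 2`, and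
their lengths are of order `2 ^ k`. By concavity of `t ↦ t ^ β` their average cost is then at most
of order `2 ^ (k * (1 - β * D))`, which is summable. -/
theorem exists_words_pathCost_rpow_le [NeZero m] {lam : (Fin m → ℤ) → ℝ} (h0 : ∀ v, 0 ≤ lam v)
    (h1 : ∀ s : Finset (Fin m → ℤ), ∑ v ∈ s, lam v ≤ 1) {β : ℝ} (hβ1 : β ≤ 1)
    (hβ : 1 < β * (m + 1).choose 2) {v : Fin m → ℤ} (hv : 0 ≤ v) :
    ∃ (S : ℝ) (w : ℕ → List (N m)), (∀ n, ∀ g ∈ w n, g ∈ generators m) ∧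
      (∀ n, pathCost (fun u => lam u ^ β) (w n) v ≤ S) ∧
      Filter.Tendsto (fun n => lam ((w n).prod • v) ^ β) Filter.atTop (nhds 0) := by
  have hβ0 : 0 < β := pos_of_mul_pos_left (one_pos.trans hβ) (Nat.cast_nonneg _)
  refine exists_words_pathCost_le (Ω := fun k => Digits m (2 ^ k)) (W := fun _ => Digits.word)
    (P := {v | 0 ≤ v}) (fun u => Real.rpow_nonneg (h0 u) β) (fun _ => Digits.word_ne_nil)
    (fun _ c => mem_generators_of_mem_blockWord _) (fun _ c u => blockWord_smul_nonneg _)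
    (fun _ u => Digits.word_prod_smul_injective)
    (fun k c => Nat.cast_le.2 (Digits.length_word_le c)) (fun k y hy => ?_)
    (summable_length_mul_card_rpow_neg hβ) hv
  rw [← card_digits m (2 ^ k)]
  refine expect_rpow_le_card_rpow_neg (fun c => h0 _) ?_ hβ0.le hβ1
  exact (Finset.sum_map Finset.univ ⟨y, hy⟩ lam).symm.trans_le (h1 _)

end Words

section Distortion

theorem exists_mem_uIcc_abs_sub_eq {F f' : I → ℝ}
    (hF : ∀ x : I, HasDerivWithinAt (Set.IccExtend (zero_le_one' ℝ) F) (f' x) (Set.Icc 0 1) x)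
    (p q : I) : ∃ ξ ∈ Set.uIcc p q, |F p - F q| = |f' ξ| * dist p q := by
  wlog hpq : p < q generalizing p q
  · rcases (not_lt.1 hpq).eq_or_lt with rfl | h
    · exact ⟨q, Set.left_mem_uIcc, by simp⟩
    · simpa only [Set.uIcc_comm, abs_sub_comm, dist_comm] using this q p h
  have hpq' : (p : ℝ) < q := hpq
  have hsub : Set.Icc (p : ℝ) q ⊆ Set.Icc 0 1 := Set.Icc_subset_Icc p.2.1 q.2.2
  have hcont : ContinuousOn (Set.IccExtend (zero_le_one' ℝ) F) (Set.Icc p q) := fun x hx =>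
    (hF ⟨x, hsub hx⟩).continuousWithinAt.mono hsub
  obtain ⟨ξ, hξ, hslope⟩ := exists_hasDerivAt_eq_slope _ (Set.IccExtend (zero_le_one' ℝ) f')
    hpq' hcont fun x hx => by
      have hx' := hsub (Set.Ioo_subset_Icc_self hx)
      rw [Set.IccExtend_of_mem _ _ hx']
      exact (hF ⟨x, hx'⟩).hasDerivAt (Icc_mem_nhds (p.2.1.trans_lt hx.1) (hx.2.trans_le q.2.2))
  have hξ' := hsub (Set.Ioo_subset_Icc_self hξ)
  rw [Set.IccExtend_of_mem _ _ hξ', Set.IccExtend_val, Set.IccExtend_val,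
    eq_div_iff (sub_pos.2 hpq').ne'] at hslope
  refine ⟨⟨ξ, hξ'⟩, Set.Icc_subset_uIcc ⟨hξ.1.le, hξ.2.le⟩, ?_⟩
  rw [abs_sub_comm, ← hslope, abs_mul, dist_comm, Subtype.dist_eq, Real.dist_eq]

theorem abs_log_sub_log_le {μ x y : ℝ} (hμ : 0 < μ) (hx : μ ≤ x) (hy : μ ≤ y) :
    |Real.log x - Real.log y| ≤ |x - y| / μ := by
  wlog hxy : y ≤ x generalizing x y
  · rw [abs_sub_comm, abs_sub_comm x]
    exact this hy hx (le_of_not_ge hxy)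
  have hy0 : 0 < y := hμ.trans_le hy
  have hx0 : 0 < x := hμ.trans_le hx
  rw [abs_of_nonneg (sub_nonneg.2 (Real.log_le_log hy0 hxy)), abs_of_nonneg (sub_nonneg.2 hxy),
    ← Real.log_div hx0.ne' hy0.ne']
  calc Real.log (x / y) ≤ x / y - 1 := Real.log_le_sub_one_of_pos (div_pos hx0 hy0)
    _ = (x - y) / y := by rw [sub_div, div_self hy0.ne']
    _ ≤ (x - y) / μ := div_le_div_of_nonneg_left (sub_nonneg.2 hxy) hμ hy

theorem IsHolderDiffeo.exists_log_deriv_holder {α β : ℝ} (hβ : 0 < β) (hβα : β ≤ α) {f : I ≃ₜ I}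
    (hf : IsHolderDiffeo α f) : ∃ f' : I → ℝ,
      (∀ x : I, HasDerivWithinAt (Set.IccExtend (zero_le_one' ℝ) fun t => (f t : ℝ)) (f' x)
        (Set.Icc 0 1) x) ∧
      ∃ C : ℝ, 0 ≤ C ∧ ∀ x y, |Real.log |f' x| - Real.log (|f' y|)| ≤ C * dist x y ^ β := by
  obtain ⟨f', hderiv, hcont, hne, M, hM⟩ := hf
  obtain ⟨x₀, -, hx₀⟩ := isCompact_univ.exists_isMinOn Set.univ_nonempty hcont.abs.continuousOn
  have hμ : 0 < |f' x₀| := abs_pos.2 (hne x₀)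
  have hmin : ∀ x, |f' x₀| ≤ |f' x| := fun x => hx₀ (Set.mem_univ x)
  refine ⟨f', hderiv, |M| / |f' x₀|, by positivity, fun x y => ?_⟩
  have hdist : dist x y ≤ 1 := by
    rw [Subtype.dist_eq]
    exact Real.dist_le_of_mem_Icc_01 x.2 y.2
  calc |Real.log |f' x| - Real.log (|f' y|)|
      ≤ |(|f' x| - |f' y|)| / |f' x₀| := abs_log_sub_log_le hμ (hmin x) (hmin y)
    _ ≤ |M| * dist x y ^ α / |f' x₀| := by
        gcongr
        exact (abs_abs_sub_abs_le _ _).trans ((hM x y).trans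
          (mul_le_mul_of_nonneg_right (le_abs_self M) (by positivity)))
    _ ≤ |M| * dist x y ^ β / |f' x₀| := by
        gcongr _ * ?_ / _
        exact Real.rpow_le_rpow_of_exponent_ge' dist_nonneg hdist hβ.le hβα
    _ = |M| / |f' x₀| * dist x y ^ β := by ring

theorem dist_le_of_mem_uIcc {p q x y : I} (hx : x ∈ Set.uIcc p q) (hy : y ∈ Set.uIcc p q) :
    dist x y ≤ dist p q :=
  Real.dist_le_of_mem_uIcc ((Subtype.mono_coe _).mapsTo_uIcc hx)
    ((Subtype.mono_coe _).mapsTo_uIcc hy)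

/-- The logarithm of the absolute value of the slope of `f` between `p` and `q`. -/
noncomputable def logSlope (f : I → I) (p q : I) : ℝ :=
  Real.log (dist (f p) (f q) / dist p q)

theorem logSlope_eq {f : I → I} (hf : f.Injective) {p q : I} (hpq : p ≠ q) :
    logSlope f p q = Real.log (dist (f p) (f q)) - Real.log (dist p q) :=
  Real.log_div (dist_ne_zero.2 (hf.ne hpq)) (dist_ne_zero.2 hpq)

theorem IsHolderDiffeo.exists_abs_logSlope_sub_le {α β : ℝ} (hβ : 0 < β) (hβα : β ≤ α)
    {f : I ≃ₜ I} (hf : IsHolderDiffeo α f) : ∃ C, 0 ≤ C ∧ ∀ P Q, ∀ p ∈ Set.uIcc P Q,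
      ∀ q ∈ Set.uIcc P Q, ∀ p' ∈ Set.uIcc P Q, ∀ q' ∈ Set.uIcc P Q, p ≠ q → p' ≠ q' →
      |logSlope f p q - logSlope f p' q'| ≤ C * dist P Q ^ β := by
  obtain ⟨f', hderiv, C, hC, hlog⟩ := hf.exists_log_deriv_holder hβ hβα
  have hmean : ∀ P Q, ∀ p ∈ Set.uIcc P Q, ∀ q ∈ Set.uIcc P Q, p ≠ q →
      ∃ ξ ∈ Set.uIcc P Q, logSlope f p q = Real.log |f' ξ| := fun P Q p hp q hq hpq => by
    obtain ⟨ξ, hξ, h⟩ := exists_mem_uIcc_abs_sub_eq hderiv p q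
    refine ⟨ξ, Set.uIcc_subset_uIcc hp hq hξ, ?_⟩
    rw [logSlope, Subtype.dist_eq (f p), Real.dist_eq, h, mul_div_cancel_right₀ _
      (dist_ne_zero.2 hpq)]
  refine ⟨C, hC, fun P Q p hp q hq p' hp' q' hq' hpq hpq' => ?_⟩
  obtain ⟨ξ, hξ, h⟩ := hmean P Q p hp q hq hpq
  obtain ⟨ξ', hξ', h'⟩ := hmean P Q p' hp' q' hq' hpq'
  rw [h, h']
  exact (hlog ξ ξ').trans (mul_le_mul_of_nonneg_left
    (Real.rpow_le_rpow dist_nonneg (dist_le_of_mem_uIcc hξ hξ') hβ.le) hC)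

theorem logSlope_of_fixed {f : I → I} {P Q : I} (hP : f P = P) (hQ : f Q = Q) :
    logSlope f P Q = 0 := by
  rw [logSlope, hP, hQ]
  rcases eq_or_ne (dist P Q) 0 with h | h
  · simp [h]
  · rw [div_self h, Real.log_one]

end Distortion

section Disjoint

theorem uIoo_subset_image_Ioo {h : I → I} (hh : Continuous h) {p q : I} (hpq : p ≤ q) :
    Set.uIoo (h p) (h q) ⊆ h '' Set.Ioo p q := by
  rcases le_total (h p) (h q) with hle | hle
  · rw [Set.uIoo_of_le hle]
    exact intermediate_value_Ioo hpq hh.continuousOn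
  · rw [Set.uIoo_of_ge hle]
    exact intermediate_value_Ioo' hpq hh.continuousOn

theorem sum_dist_image_le_one {ι : Type*} {a b : ι → I} {h : I → I} (hh : Continuous h)
    (hinj : h.Injective) (hab : ∀ i, a i ≤ b i)
    (hdisj : Pairwise (Function.onFun Disjoint fun i => Set.Ioo (a i) (b i))) (s : Finset ι) :
    ∑ i ∈ s, dist (h (a i)) (h (b i)) ≤ 1 := by
  have hdisj' : (s : Set ι).PairwiseDisjoint fun i => Set.uIoo (h (a i)) (h (b i)) :=
    fun i _ j _ hij => ((Set.disjoint_image_iff hinj).2 (hdisj hij)).mono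
      (uIoo_subset_image_Ioo hh (hab i)) (uIoo_subset_image_Ioo hh (hab j))
  have hvol : ENNReal.ofReal (∑ i ∈ s, dist (h (a i)) (h (b i))) ≤ ENNReal.ofReal 1 := by
    calc ENNReal.ofReal (∑ i ∈ s, dist (h (a i)) (h (b i)))
        = ∑ i ∈ s, MeasureTheory.volume (Set.uIoo (h (a i)) (h (b i))) := by
          rw [ENNReal.ofReal_sum_of_nonneg fun i _ => dist_nonneg]
          simp only [unitInterval.volume_uIoo, edist_dist, dist_comm]
      _ = MeasureTheory.volume (⋃ i ∈ s, Set.uIoo (h (a i)) (h (b i))) :=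
          (MeasureTheory.measure_biUnion_finset hdisj' fun i _ => measurableSet_Ioo).symm
      _ ≤ ENNReal.ofReal 1 := ENNReal.ofReal_one.symm ▸ MeasureTheory.prob_le_one
  exact (ENNReal.ofReal_le_ofReal_iff zero_le_one).1 hvol

end Disjoint

section Rows

variable {m : ℕ}

theorem toLex_snoc_lt_of_toLex_lt {v w : Fin m → ℤ} (h : toLex v < toLex w) (s t : ℤ) :
    toLex (Fin.snoc v s : Fin (m + 1) → ℤ) < toLex (Fin.snoc w t : Fin (m + 1) → ℤ) := by
  obtain ⟨i, hi, hlt⟩ := h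
  refine ⟨i.castSucc, fun j hj => ?_, ?_⟩
  · obtain ⟨j, rfl⟩ := Fin.exists_castSucc_eq.2 (hj.trans (Fin.castSucc_lt_last i)).ne
    simpa using hi j (Fin.castSucc_lt_castSucc_iff.1 hj)
  · simpa using hlt

/-- The family of intervals `[a v, b v]`, `v ∈ ℤ^d`, is nondegenerate and placed in `[0, 1]` in the
lexicographic order of its indices; unlike in `IsLexFamily`, the intervals may leave gaps. -/
structure IsLexOrdered {d : ℕ} (a b : (Fin d → ℤ) → I) : Prop where
  lt : ∀ v, a v < b v
  lex : ∀ v w, toLex v < toLex w → b v ≤ a w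

theorem IsLexOrdered.pairwise_disjoint {d : ℕ} {a b : (Fin d → ℤ) → I} (hab : IsLexOrdered a b) :
    Pairwise (Function.onFun Disjoint fun v => Set.Ioo (a v) (b v)) := by
  have hdisj : ∀ v w, toLex v < toLex w → Disjoint (Set.Ioo (a v) (b v)) (Set.Ioo (a w) (b w)) :=
    fun v w h => Set.disjoint_left.2 fun _ hv hw => (hv.2.trans_le (hab.lex v w h)).not_gt hw.1
  intro v w hvw
  rcases lex_trichotomy v w with h | h | h
  · exact hdisj v w h
  · exact absurd h hvw
  · exact (hdisj w v h).symm

/-- The left end of the row of `v`, which consists of the intervals with index `(v, t)`, `t ∈ ℤ`. -/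
noncomputable def rowInf (a : (Fin (m + 1) → ℤ) → I) (v : Fin m → ℤ) : I :=
  ⨅ t : ℤ, a (Fin.snoc v t)

/-- The right end of the row of `v`, which consists of the intervals with index `(v, t)`,
`t ∈ ℤ`. -/
noncomputable def rowSup (b : (Fin (m + 1) → ℤ) → I) (v : Fin m → ℤ) : I :=
  ⨆ t : ℤ, b (Fin.snoc v t)

variable {a b : (Fin (m + 1) → ℤ) → I}

theorem rowInf_le (a : (Fin (m + 1) → ℤ) → I) (v : Fin m → ℤ) (t : ℤ) :
    rowInf a v ≤ a (Fin.snoc v t) :=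
  iInf_le _ t

theorem le_rowSup (b : (Fin (m + 1) → ℤ) → I) (v : Fin m → ℤ) (t : ℤ) :
    b (Fin.snoc v t) ≤ rowSup b v :=
  le_iSup (fun t : ℤ => b (Fin.snoc v t)) t

theorem IsLexOrdered.row (hab : IsLexOrdered a b) : IsLexOrdered (rowInf a) (rowSup b) where
  lt v := (rowInf_le a v 0).trans_lt ((hab.lt _).trans_le (le_rowSup b v 0))
  lex _ _ h := iSup_le fun s => le_iInf fun t => hab.lex _ _ (toLex_snoc_lt_of_toLex_lt h s t)

theorem map_rowInf {f : I → I} (hf : Continuous f) (hmono : Monotone f) {v w : Fin m → ℤ} {c : ℤ}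
    (h : ∀ t, f (a (Fin.snoc v t)) = a (Fin.snoc w (t + c))) : f (rowInf a v) = rowInf a w := by
  rw [rowInf, hmono.map_ciInf_of_continuousAt hf.continuousAt (OrderBot.bddBelow _)]
  simp only [h]
  exact (Equiv.addRight c).iInf_comp (g := fun t => a (Fin.snoc w t))

theorem map_rowSup {f : I → I} (hf : Continuous f) (hmono : Monotone f) {v w : Fin m → ℤ} {c : ℤ}
    (h : ∀ t, f (b (Fin.snoc v t)) = b (Fin.snoc w (t + c))) : f (rowSup b v) = rowSup b w := by
  rw [rowSup, hmono.map_ciSup_of_continuousAt hf.continuousAt (OrderTop.bddAbove _)]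
  simp only [h]
  exact (Equiv.addRight c).iSup_comp (g := fun t => b (Fin.snoc w t))

theorem map_endpoints_of_image_Icc {f : I → I} (hf : Monotone f) {p q p' q' : I} (hpq : p ≤ q)
    (hpq' : p' ≤ q') (him : f '' Set.Icc p q = Set.Icc p' q') : f p = p' ∧ f q = q' :=
  ⟨((hf.monotoneOn _).map_isLeast (isLeast_Icc hpq)).unique (him ▸ isLeast_Icc hpq'),
    ((hf.monotoneOn _).map_isGreatest (isGreatest_Icc hpq)).unique (him ▸ isGreatest_Icc hpq')⟩

end Rows

section Cocycle

variable {m : ℕ} {a b : (Fin (m + 1) → ℤ) → I} {h : I ≃ₜ I} {φ ψ : N (m + 1) →* (I ≃ₜ I)}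
  {α β : ℝ}

/-- The logarithm of the ratio between the lengths of the images under `h` of the intervals
`[a, b]` with indices `(v, k)` and `(v, 0)`. -/
noncomputable def logRatio (h : I → I) (a b : (Fin (m + 1) → ℤ) → I) (k : ℤ) (v : Fin m → ℤ) : ℝ :=
  Real.log (dist (h (a (Fin.snoc v k))) (h (b (Fin.snoc v k)))) -
    Real.log (dist (h (a (Fin.snoc v 0))) (h (b (Fin.snoc v 0))))

/-- The length of the image under `h` of the row of `v`. -/
noncomputable def rowLength (h : I → I) (a b : (Fin (m + 1) → ℤ) → I) (v : Fin m → ℤ) : ℝ :=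
  dist (h (rowInf a v)) (h (rowSup b v))

theorem homeomorph_mapsTo_uIcc (h : I ≃ₜ I) (p q : I) :
    Set.MapsTo h (Set.Icc p q) (Set.uIcc (h p) (h q)) := by
  rcases h.continuous.strictMono_of_inj h.injective with hh | hh
  · exact (hh.monotone.mapsTo_Icc).mono_right Set.Icc_subset_uIcc
  · exact (hh.antitone.mapsTo_Icc).mono_right Set.Icc_subset_uIcc'

theorem IsLexOrdered.map_mem_row (hab : IsLexOrdered a b) (h : I ≃ₜ I) (v : Fin m → ℤ) (t : ℤ) :
    h (a (Fin.snoc v t)) ∈ Set.uIcc (h (rowInf a v)) (h (rowSup b v)) ∧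
      h (b (Fin.snoc v t)) ∈ Set.uIcc (h (rowInf a v)) (h (rowSup b v)) :=
  ⟨homeomorph_mapsTo_uIcc h _ _ ⟨rowInf_le a v t, (hab.lt _).le.trans (le_rowSup b v t)⟩,
    homeomorph_mapsTo_uIcc h _ _ ⟨(rowInf_le a v t).trans (hab.lt _).le, le_rowSup b v t⟩⟩

theorem IsLexOrdered.map_ne {d : ℕ} {a b : (Fin d → ℤ) → I} (hab : IsLexOrdered a b) (h : I ≃ₜ I)
    (v : Fin d → ℤ) :
    h (a v) ≠ h (b v) :=
  h.injective.ne (hab.lt v).ne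

variable (hab : IsLexOrdered a b)
include hab

theorem exists_abs_logRatio_smul_sub_le (hβ : 0 < β) (hβα : β ≤ α) {f : I ≃ₜ I}
    (hf : IsHolderDiffeo α f) {g : N m}
    (ha : ∀ v t, f (h (a (Fin.snoc v t))) = h (a (Fin.snoc (g • v) t)))
    (hb : ∀ v t, f (h (b (Fin.snoc v t))) = h (b (Fin.snoc (g • v) t))) :
    ∃ C, 0 ≤ C ∧ ∀ k v,
      |logRatio h a b k (g • v) - logRatio h a b k v| ≤ C * rowLength h a b v ^ β := by
  obtain ⟨C, hC, hslope⟩ := hf.exists_abs_logSlope_sub_le hβ hβα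
  refine ⟨C, hC, fun k v => ?_⟩
  have hmem := hab.map_mem_row h v
  have heq : logRatio h a b k (g • v) - logRatio h a b k v =
      logSlope f (h (a (Fin.snoc v k))) (h (b (Fin.snoc v k))) -
        logSlope f (h (a (Fin.snoc v 0))) (h (b (Fin.snoc v 0))) := by
    simp only [logSlope_eq f.injective (hab.map_ne h _), logRatio, ha, hb]
    ring
  rw [heq]
  exact hslope _ _ _ (hmem k).1 _ (hmem k).2 _ (hmem 0).1 _ (hmem 0).2 (hab.map_ne h _)
    (hab.map_ne h _)

theorem exists_abs_logRatio_le (hβ : 0 < β) (hβα : β ≤ α) {f : I ≃ₜ I} (hf : IsHolderDiffeo α f)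
    {k : ℤ} (ha : ∀ v, f (h (a (Fin.snoc v 0))) = h (a (Fin.snoc v k)))
    (hb : ∀ v, f (h (b (Fin.snoc v 0))) = h (b (Fin.snoc v k)))
    (hinf : ∀ v, f (h (rowInf a v)) = h (rowInf a v))
    (hsup : ∀ v, f (h (rowSup b v)) = h (rowSup b v)) :
    ∃ C, ∀ v, |logRatio h a b k v| ≤ C * rowLength h a b v ^ β := by
  obtain ⟨C, -, hslope⟩ := hf.exists_abs_logSlope_sub_le hβ hβα
  refine ⟨C, fun v => ?_⟩
  have hmem := hab.map_mem_row h v 0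
  have heq : logRatio h a b k v = logSlope f (h (a (Fin.snoc v 0))) (h (b (Fin.snoc v 0))) -
      logSlope f (h (rowInf a v)) (h (rowSup b v)) := by
    rw [logSlope_of_fixed (hinf v) (hsup v), sub_zero, logSlope_eq f.injective (hab.map_ne h _),
      logRatio, ha, hb]
  rw [heq]
  exact hslope _ _ _ hmem.1 _ hmem.2 _ Set.left_mem_uIcc _ Set.right_mem_uIcc (hab.map_ne h _)
    (hab.row.map_ne h v)

variable (hψ : ∀ g, IsHolderDiffeo α (ψ g)) (hconj : ∀ g x, h (φ g x) = ψ g (h x))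
  (ha : ∀ g v, φ g (a v) = a (g • v)) (hb : ∀ g v, φ g (b v) = b (g • v))
include hψ hconj ha hb

theorem exists_forall_mem_generators_abs_logRatio_smul_sub_le (hβ : 0 < β) (hβα : β ≤ α) :
    ∃ C, 0 ≤ C ∧ ∀ g ∈ generators m, ∀ k v,
      |logRatio h a b k (g • v) - logRatio h a b k v| ≤ C * rowLength h a b v ^ β := by
  have hgen : ∀ p : Σ i : Fin m, Fin (i + 1), ∃ C, 0 ≤ C ∧ ∀ k v,
      |logRatio h a b k (shear p.1 p.2 1 • v) - logRatio h a b k v| ≤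
        C * rowLength h a b v ^ β := fun ⟨i, j⟩ =>
    exists_abs_logRatio_smul_sub_le hab hβ hβα (hψ (shear i.castSucc j 1))
      (fun v t => by rw [← hconj, ha, shear_castSucc_smul_snoc])
      (fun v t => by rw [← hconj, hb, shear_castSucc_smul_snoc])
  choose C hC hle using hgen
  refine ⟨∑ p, C p, Finset.sum_nonneg fun p _ => hC p, ?_⟩
  rintro _ ⟨p, rfl⟩ k v
  exact (hle p k v).trans (mul_le_mul_of_nonneg_right
    (Finset.single_le_sum (fun p _ => hC p) (Finset.mem_univ p))
    (Real.rpow_nonneg dist_nonneg β))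

theorem exists_abs_logRatio_le_of_conj (hφ : ∀ g, Monotone (φ g)) (hβ : 0 < β) (hβα : β ≤ α)
    (k : ℤ) : ∃ C, ∀ v, |logRatio h a b k v| ≤ C * rowLength h a b v ^ β := by
  have ha' : ∀ v t, φ (shear (Fin.last m) 0 k) (a (Fin.snoc v t)) = a (Fin.snoc v (t + k)) :=
    fun v t => by rw [ha, shear_last_zero_smul_snoc]
  have hb' : ∀ v t, φ (shear (Fin.last m) 0 k) (b (Fin.snoc v t)) = b (Fin.snoc v (t + k)) :=
    fun v t => by rw [hb, shear_last_zero_smul_snoc]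
  refine exists_abs_logRatio_le hab hβ hβα (hψ (shear (Fin.last m) 0 k)) ?_ ?_ ?_ ?_ <;> intro v <;>
    rw [← hconj]
  · rw [ha', zero_add]
  · rw [hb', zero_add]
  · rw [map_rowInf (Homeomorph.continuous _) (hφ _) (ha' v)]
  · rw [map_rowSup (Homeomorph.continuous _) (hφ _) (hb' v)]

theorem exists_forall_abs_logRatio_zero_le [NeZero m] (hφ : ∀ g, Monotone (φ g)) (hβ1 : β ≤ 1)
    (hβα : β ≤ α) (hβ : 1 < β * (m + 1).choose 2) : ∃ C, ∀ k, |logRatio h a b k 0| ≤ C := by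
  have hβ0 : 0 < β := pos_of_mul_pos_left (one_pos.trans hβ) (Nat.cast_nonneg _)
  obtain ⟨S, w, hw, hS, hlim⟩ := exists_words_pathCost_rpow_le (lam := rowLength h a b)
    (fun _ => dist_nonneg) (sum_dist_image_le_one h.continuous h.injective
      (fun v => (hab.row.lt v).le) hab.row.pairwise_disjoint) hβ1 hβ le_rfl
  obtain ⟨C, hC, hgen⟩ :=
    exists_forall_mem_generators_abs_logRatio_smul_sub_le hab hψ hconj ha hb hβ0 hβα
  refine ⟨C * S, fun k => ?_⟩
  obtain ⟨Ck, hCk⟩ := exists_abs_logRatio_le_of_conj hab hψ hconj ha hb hφ hβ0 hβα k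
  exact abs_le_mul_of_tendsto hC (fun g hg => hgen g hg k) hCk hw hS hlim

end Cocycle

section Unbounded

theorem exists_lt_abs_log_sub_log {ι : Type*} [Infinite ι] {r : ι → ℝ} (hr : ∀ i, 0 < r i)
    {A : ℝ} (hsum : ∀ s : Finset ι, ∑ i ∈ s, r i ≤ A) (i : ι) (C : ℝ) :
    ∃ k, C < |Real.log (r k) - Real.log (r i)| := by
  have hlim := (summable_of_sum_le (fun i => (hr i).le) hsum).tendsto_cofinite_zero
  obtain ⟨k, hk⟩ :=
    (hlim.eventually_lt_const (mul_pos (hr i) (Real.exp_pos (-C)))).exists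
  have hlog := Real.log_lt_log (hr k) hk
  rw [Real.log_mul (hr i).ne' (Real.exp_pos _).ne', Real.log_exp] at hlog
  exact ⟨k, lt_abs.2 (Or.inr (by linarith))⟩

theorem IsLexOrdered.exists_lt_abs_logRatio {m : ℕ} {a b : (Fin (m + 1) → ℤ) → I}
    (hab : IsLexOrdered a b) (h : I ≃ₜ I) (v : Fin m → ℤ) (C : ℝ) :
    ∃ k, C < |logRatio h a b k v| :=
  exists_lt_abs_log_sub_log (fun k => dist_pos.2 (hab.map_ne h (Fin.snoc v k)))
    (sum_dist_image_le_one h.continuous h.injective (fun _ => (hab.lt _).le) fun _ _ hkl =>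
      hab.pairwise_disjoint fun heq => hkl (Fin.snoc_inj.1 heq).2) 0 C

end Unbounded

end FarbFranks

theorem theoremA_general (d : ℕ) (hd : 3 ≤ d) (α : ℝ) (hα : 2 / ((d : ℝ) * ((d : ℝ) - 1)) < α)
    (φ : FarbFranks.N d →* (unitInterval ≃ₜ unitInterval)) (hφ : ∀ g, Monotone (φ g))
    (a b : (Fin d → ℤ) → unitInterval) (hab : FarbFranks.IsLexOrdered a b)
    (him : ∀ g v, φ g '' Set.Icc (a v) (b v) =
      Set.Icc (a (FarbFranks.act g v)) (b (FarbFranks.act g v))) :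
    ¬ ∃ ψ : FarbFranks.N d →* (unitInterval ≃ₜ unitInterval),
      (∀ g, FarbFranks.IsHolderDiffeo α (ψ g)) ∧ FarbFranks.TopConjugate φ ψ := by
  rintro ⟨ψ, hψ, h, hconj⟩
  obtain ⟨m, rfl⟩ : ∃ m, d = m + 1 := ⟨d - 1, by omega⟩
  have : NeZero m := ⟨by omega⟩
  have hends := fun g v => FarbFranks.map_endpoints_of_image_Icc (hφ g) (hab.lt v).le
    (hab.lt (FarbFranks.act g v)).le (him g v)
  have hchoose : (3 : ℝ) ≤ (m + 1).choose 2 := by exact_mod_cast Nat.choose_le_choose 2 hd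
  have hβ : 1 < min α 1 * (m + 1).choose 2 := by
    rw [← div_lt_iff₀ (by linarith), lt_min_iff]
    refine ⟨hα.trans_eq' ?_, (div_lt_one (by linarith)).2 (by linarith)⟩
    rw [Nat.cast_choose_two, one_div_div]
  obtain ⟨C, hC⟩ := FarbFranks.exists_forall_abs_logRatio_zero_le hab hψ hconj
    (fun g v => (hends g v).1) (fun g v => (hends g v).2) hφ (min_le_right α 1) (min_le_left α 1) hβ
  obtain ⟨k, hk⟩ := hab.exists_lt_abs_logRatio h 0 C
  exact hk.not_ge (hC k)

theorem theoremA (d : ℕ) (hd : 3 ≤ d) (α : ℝ) (hα : 2 / ((d : ℝ) * ((d : ℝ) - 1)) < α)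
    (φ : FarbFranks.N d →* (unitInterval ≃ₜ unitInterval))
    (hφ : FarbFranks.IsFarbFranksAction d φ) :
    ¬ ∃ ψ : FarbFranks.N d →* (unitInterval ≃ₜ unitInterval),
      (∀ g, FarbFranks.IsHolderDiffeo α (ψ g)) ∧ FarbFranks.TopConjugate φ ψ := by
  obtain ⟨hmono, a, b, hab, him, -⟩ := hφ
  exact theoremA_general d hd α hα φ hmono a b ⟨hab.lt, hab.lex⟩ him
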